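/- Let $k$ be an algebraically closed field. All categories and functors are $k$-linear. A \emph{finite $k$-variety} is a $k$-linear additive category with finite-dimensional $\operatorname{Hom}$-spaces in which all idempotents split. For a finite $k$-variety $\mathfrak{a}$, let $\operatorname{mod}\mathfrak{a}$ be the category of finitely presented right $\mathfrak{a}$-modules, i.e. of contravariant functors $M$ from $\mathfrak{a}$ to $k$-vector spaces admitting an exact sequence $\mathfrak{a}(-,A_1)\to\mathfrak{a}(-,A_0)\to M\to 0$, and let $\operatorname{mod}\mathfrak{a}^\circ$ be the corresponding category for the opposite category $\mathfrak{a}^\circ$. The finite $k$-variety $\mathfrak{a}$ is \emph{dualizing} if the pointwise dual $D$, given by $(DM)(X)=\operatorname{Hom}_k(M(X),k)$, restricts to a duality (contravariant equivalence) $D:\operatorname{mod}\mathfrak{a}\to\operatorname{mod}\mathfrak{a}^\circ$. A \emph{Serre functor} on a $\operatorname{Hom}$-finite $k$-linear category $\mathcal{C}$ is an additive auto-equivalence $\mathbb{S}:\mathcal{C}\to\mathcal{C}$ together with $k$-linear isomorphisms $\operatorname{Hom}(X,Y)\cong\operatorname{Hom}(Y,\mathbb{S}X)^*$, natural in $X,Y\in\operatorname{Ob}\mathcal{C}$,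 where $(-)^*$ is the $k$-dual. An abelian $k$-linear category $\mathcal{A}$ \emph{satisfies Serre duality} if its bounded derived category $D^b\mathcal{A}$ is $\operatorname{Hom}$-finite and admits a Serre functor. \textbf{Proposition.} Let $\mathfrak{a}$ be a dualizing $k$-variety, $\mathfrak{b}$ a finite $k$-variety, and $i:\mathfrak{b}\to\mathfrak{a}$ a fully faithful ($k$-linear) functor admitting both a left adjoint and a right adjoint. Then $\mathfrak{b}$ is also a dualizing $k$-variety. Furthermore, if $\operatorname{mod}\mathfrak{a}$ is abelian and satisfies Serre duality, then $\operatorname{mod}\mathfrak{b}$ is abelian and satisfies Serre duality. -/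

import Mathlib

open CategoryTheory CategoryTheory.Limits Opposite

universe w v v₁ v₂ u u₁ u₂

section Serre

variable (k : Type w) [Field k]

/-- A Hom-finite `k`-linear category: all morphism spaces are finite dimensional. -/
def HomFinite (C : Type u) [Category.{v} C] [Preadditive C] [CategoryTheory.Linear k C] : Prop :=
  ∀ X Y : C, Module.Finite k (X ⟶ Y)

/-- A Serre functor on a `k`-linear category `C`: an additive auto-equivalence `S` together with
`k`-linear isomorphisms `Hom(X, Y) ≅ Hom(Y, S X)^*`, natural in `X` and `Y`. -/
structure SerreFunctor (C : Type u) [Category.{v} C] [Preadditive C]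
    [CategoryTheory.Linear k C] where
  /-- the auto-equivalence -/
  S : C ≌ C
  additive : S.functor.Additive
  /-- the duality isomorphisms -/
  iso : ∀ X Y : C, (X ⟶ Y) ≃ₗ[k] Module.Dual k (Y ⟶ S.functor.obj X)
  naturality : ∀ {X X' Y Y' : C} (f : X' ⟶ X) (h : X ⟶ Y) (g : Y ⟶ Y')
    (t : Y' ⟶ S.functor.obj X'),
    iso X' Y' (f ≫ h ≫ g) t = iso X Y h (g ≫ t ≫ S.functor.map f)

/-- An abelian `k`-linear category satisfies Serre duality if its bounded derived category is
Hom-finite and admits a Serre functor.  The (standard) model of the derived category that is used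
is irrelevant, since any two are equivalent. -/
def AbelianSerreDuality (A : Type u) [Category.{v} A] [Abelian A]
    [CategoryTheory.Linear k A] : Prop :=
  letI : HasDerivedCategory.{max u v} A := HasDerivedCategory.standard A
  HomFinite k (DerivedCategory.Bounded A) ∧ Nonempty (SerreFunctor k (DerivedCategory.Bounded A))

/-- The property, of a preadditive category, that it is abelian. -/
structure IsAbelianCategory (A : Type u) [Category.{v} A] [Preadditive A] : Prop where
  hasFiniteProducts : HasFiniteProducts A
  hasKernels : HasKernels A
  hasCokernels : HasCokernels A
  normalMono : IsNormalMonoCategory A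
  normalEpi : IsNormalEpiCategory A

/-- The abelian category structure on an abelian category, with the given preadditive structure. -/
abbrev IsAbelianCategory.abelian {A : Type u} [Category.{v} A] [P : Preadditive A]
    (h : IsAbelianCategory A) : Abelian A :=
  { toPreadditive := P
    toIsNormalMonoCategory := h.normalMono
    toIsNormalEpiCategory := h.normalEpi
    has_finite_products := h.hasFiniteProducts
    has_kernels := h.hasKernels
    has_cokernels := h.hasCokernels }

/-- The `k`-linear category `A` is abelian and satisfies Serre duality. -/
def SatisfiesSerreDuality (A : Type u) [Category.{v} A] [P : Preadditive A]
    [L : CategoryTheory.Linear k A] : Prop :=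
  ∃ h : IsAbelianCategory A, @AbelianSerreDuality k _ A _ h.abelian L

end Serre

section Varieties

variable (k : Type v) [Field k]

/-- A finite `k`-variety: a Hom-finite additive `k`-linear category in which idempotents split. -/
structure IsFiniteVariety (C : Type u) [Category.{v} C] [Preadditive C]
    [CategoryTheory.Linear k C] : Prop where
  hasFiniteBiproducts : HasFiniteBiproducts C
  homFinite : HomFinite k C
  idempotentsSplit : IsIdempotentComplete C

/-- `M` is the cokernel of a morphism between two objects in the image of `R`. -/
def PresentedBy {I : Type u₁} [Category.{v₁} I] {F : Type u₂} [Category.{v₂} F] [HasZeroMorphisms F]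
    (R : I ⥤ F) : ObjectProperty F :=
  fun M => ∃ (A₁ A₀ : I) (f : R.obj A₁ ⟶ R.obj A₀) (p : R.obj A₀ ⟶ M) (hp : f ≫ p = 0),
    Nonempty (IsColimit (CokernelCofork.ofπ p hp))

variable (C : Type u) [Category.{v} C] [Preadditive C] [CategoryTheory.Linear k C]

/-- Finitely presented right `C`-modules: contravariant functors `M` with an exact sequence
`C(-, A₁) ⟶ C(-, A₀) ⟶ M ⟶ 0`.  (When `C` has finite direct sums, one standard projective on
each side is enough.  Such an `M` is `k`-linear, and its values are finite dimensional when `C` is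
Hom-finite.) -/
abbrev FPRight : ObjectProperty (Cᵒᵖ ⥤ ModuleCat.{v} k) := PresentedBy (linearYoneda k C)

/-- Finitely presented right modules over the opposite category of `C`, that is, covariant
functors `N` with an exact sequence `C(A₁, -) ⟶ C(A₀, -) ⟶ N ⟶ 0`. -/
abbrev FPLeft : ObjectProperty (C ⥤ ModuleCat.{v} k) := PresentedBy (linearCoyoneda k C)

/-- The category `mod C` of finitely presented right `C`-modules. -/
abbrev ModFP : Type (max u (v + 1)) := (FPRight k C).FullSubcategory

/-- The category `mod Cᵒᵖ` of finitely presented left `C`-modules. -/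
abbrev ModFPOp : Type (max u (v + 1)) := (FPLeft k C).FullSubcategory

/-- Pointwise `k`-dual `D`, with `(D M)(X) = Hom_k(M(X), k)`, from right to left modules. -/
def moduleDual : (Cᵒᵖ ⥤ ModuleCat.{v} k)ᵒᵖ ⥤ (C ⥤ ModuleCat.{v} k) where
  obj M :=
    { obj := fun X => ModuleCat.of k (Module.Dual k (M.unop.obj (op X)))
      map := fun f => ModuleCat.ofHom (M.unop.map f.op).hom.dualMap
      map_id := fun X => by ext; simp
      map_comp := fun f g => by ext; simp }
  map a :=
    { app := fun X => ModuleCat.ofHom (a.unop.app (op X)).hom.dualMap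
      naturality := fun X Y f => by
        ext φ : 2
        refine LinearMap.ext fun x => ?_
        exact (congrArg (fun t => φ (t.hom x)) (a.unop.naturality f.op)).symm }
  map_id M := by ext; simp
  map_comp a b := by ext; simp

/-- `C` is a dualizing `k`-variety: it is a finite `k`-variety and `D` restricts to a duality
(a contravariant equivalence) `mod C ⟶ mod Cᵒᵖ`. -/
structure IsDualizing : Prop where
  isFiniteVariety : IsFiniteVariety k C
  duality : ∃ h : ∀ M : (ModFP k C)ᵒᵖ, FPLeft k C (((FPRight k C).ι.op ⋙ moduleDual k C).obj M),
    ((FPLeft k C).lift ((FPRight k C).ι.op ⋙ moduleDual k C) h).IsEquivalence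

end Varieties

-- Let `l ⊣ i ⊣ r`. Restriction of modules is pointwise, so it commutes with `D`, and it preserves
-- finite presentation as soon as it preserves representables. The isomorphism `𝔟(l -, Y) ≅ 𝔞(-, i
-- Y)` and its three companions provide this. A `𝔟`-module can thus be extended to `𝔞`, dualized
-- there and restricted back, so `𝔟` is dualizing (`IsDualizing.of_adjunctions`).
--
-- Restriction along `l`, `i`, `r` gives `L ⊣ G ⊣ R` between `mod 𝔟` and `mod 𝔞`, with `L` and `R`
-- fully faithful. All three are exact because monos and epis over a dualizing variety are
-- pointwise. Hence `mod 𝔟` is abelian, and the triple passes to bounded derived categories with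
-- `L`, `R` still fully faithful. If `S` is the Serre functor upstairs, then `Hom(X, Y) ≅ Hom(LX,
-- LY) ≅ Hom(LY, SLX)^* ≅ Hom(Y, GSLX)^*`. This formula alone forces `GSL` to be fully faithful.
-- Essential surjectivity comes from `R`: `Hom(X, Y) ≅ Hom(RX, RY) ≅ Hom(GS⁻¹RY, X)^*`
-- (`SerreFunctor.nonempty_of_adjunctions`).

universe w₁ w₂ u₃ v₃

/-! ### Linear hom-set bijections -/

section LinearAdjunction

variable {k : Type w} [Field k]
  {C : Type u₁} [Category.{v₁} C] [Preadditive C] [CategoryTheory.Linear k C]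
  {D : Type u₂} [Category.{v₂} D] [Preadditive D] [CategoryTheory.Linear k D]

/-- The inverse of the hom-set bijection of an adjunction, as a linear equivalence, when the left
adjoint is linear. -/
def CategoryTheory.Adjunction.linearHomEquivSymm {L : D ⥤ C} {G : C ⥤ D} (adj : L ⊣ G)
    [L.Additive] [L.Linear k] (X : D) (Y : C) : (X ⟶ G.obj Y) ≃ₗ[k] (L.obj X ⟶ Y) :=
  { (adj.homEquiv X Y).symm with
    map_add' := fun f g => by simp [Adjunction.homEquiv_counit, Preadditive.add_comp]
    map_smul' := fun r f => by simp [Adjunction.homEquiv_counit] }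

@[simp]
lemma CategoryTheory.Adjunction.linearHomEquivSymm_apply {L : D ⥤ C} {G : C ⥤ D} (adj : L ⊣ G)
    [L.Additive] [L.Linear k] (X : D) (Y : C) (f : X ⟶ G.obj Y) :
    adj.linearHomEquivSymm (k := k) X Y f = L.map f ≫ adj.counit.app Y :=
  Adjunction.homEquiv_counit ..

/-- The hom-set bijection of an adjunction, as a linear equivalence, when the right adjoint is
linear. -/
def CategoryTheory.Adjunction.linearHomEquiv {L : D ⥤ C} {G : C ⥤ D} (adj : L ⊣ G)
    [G.Additive] [G.Linear k] (X : D) (Y : C) : (L.obj X ⟶ Y) ≃ₗ[k] (X ⟶ G.obj Y) :=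
  { adj.homEquiv X Y with
    map_add' := fun f g => by simp [Adjunction.homEquiv_unit, Preadditive.comp_add]
    map_smul' := fun r f => by simp [Adjunction.homEquiv_unit] }

@[simp]
lemma CategoryTheory.Adjunction.linearHomEquiv_apply {L : D ⥤ C} {G : C ⥤ D} (adj : L ⊣ G)
    [G.Additive] [G.Linear k] (X : D) (Y : C) (f : L.obj X ⟶ Y) :
    adj.linearHomEquiv (k := k) X Y f = adj.unit.app X ≫ G.map f :=
  Adjunction.homEquiv_unit ..

variable (k) in
/-- The action on morphisms of a fully faithful linear functor, as a linear equivalence. -/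
noncomputable def CategoryTheory.Functor.mapLinearEquiv (F : D ⥤ C) [F.Additive] [F.Linear k]
    [F.Full] [F.Faithful] (X Y : D) : (X ⟶ Y) ≃ₗ[k] (F.obj X ⟶ F.obj Y) :=
  LinearEquiv.ofBijective (F.mapLinearMap k) ⟨F.map_injective, F.map_surjective⟩

@[simp]
lemma CategoryTheory.Functor.mapLinearEquiv_apply (F : D ⥤ C) [F.Additive] [F.Linear k]
    [F.Full] [F.Faithful] (X Y : D) (f : X ⟶ Y) : F.mapLinearEquiv k X Y f = F.map f := rfl

lemma HomFinite.of_fullyFaithful (hC : HomFinite k C) (F : D ⥤ C) [F.Additive] [F.Linear k]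
    [F.Full] [F.Faithful] : HomFinite k D := fun X Y =>
  have := hC (F.obj X) (F.obj Y)
  Module.Finite.equiv (F.mapLinearEquiv k X Y).symm

end LinearAdjunction

/-! ### Serre duality for endofunctors, and its descent along an adjoint triple -/

section RightSerre

variable {k : Type w} [Field k]
  {C : Type u₁} [Category.{v₁} C] [Preadditive C] [CategoryTheory.Linear k C]
  {D : Type u₂} [Category.{v₂} D] [Preadditive D] [CategoryTheory.Linear k D]

/-- Serre duality isomorphisms for an endofunctor which is not assumed to be an equivalence. -/
structure RightSerre (k : Type w) [Field k] {D : Type u₂} [Category.{v₂} D] [Preadditive D]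
    [CategoryTheory.Linear k D] (S : D ⥤ D) where
  /-- the duality isomorphisms -/
  iso : ∀ X Y : D, (X ⟶ Y) ≃ₗ[k] Module.Dual k (Y ⟶ S.obj X)
  naturality : ∀ {X X' Y Y' : D} (f : X' ⟶ X) (h : X ⟶ Y) (g : Y ⟶ Y')
    (t : Y' ⟶ S.obj X'),
    iso X' Y' (f ≫ h ≫ g) t = iso X Y h (g ≫ t ≫ S.map f)

namespace RightSerre

variable {S : D ⥤ D} (σ : RightSerre k S)

/-- The trace form of a Serre duality. -/
def tr (X : D) : Module.Dual k (X ⟶ S.obj X) := σ.iso X X (𝟙 X)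

lemma iso_apply {X Y : D} (h : X ⟶ Y) (t : Y ⟶ S.obj X) : σ.iso X Y h t = σ.tr X (h ≫ t) := by
  simpa [tr] using σ.naturality (𝟙 X) (𝟙 X) h t

lemma tr_comp {X Y : D} (h : X ⟶ Y) (t : Y ⟶ S.obj X) :
    σ.tr X (h ≫ t) = σ.tr Y (t ≫ S.map h) := by
  rw [← iso_apply]
  simpa [tr] using σ.naturality h (𝟙 Y) (𝟙 Y) t

-- By `tr_comp`, the functional attached to `f` is `t ↦ tr (t ≫ S f)`, which depends only on `S f`.
include σ in
lemma faithful : S.Faithful where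
  map_injective {X Y} f g hfg := by
    apply (σ.iso X Y).injective
    ext t
    rw [iso_apply, iso_apply, tr_comp, σ.tr_comp g, hfg]

/-- Every functional on `Hom(Z, S Y)` is `s ↦ tr (t ≫ s)` for some `t`, and functionals separate
vectors; no finiteness is needed. -/
lemma eq_of_tr {Y Z : D} {s s' : Z ⟶ S.obj Y}
    (h : ∀ t : Y ⟶ Z, σ.tr Y (t ≫ s) = σ.tr Y (t ≫ s')) : s = s' := by
  rw [← sub_eq_zero, ← Module.forall_dual_apply_eq_zero_iff k]
  intro φ
  obtain ⟨t, rfl⟩ := (σ.iso Y Z).surjective φ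
  rw [iso_apply, Preadditive.comp_sub, map_sub, h, sub_self]

include σ in
lemma full : S.Full where
  map_surjective {X Y} s := by
    -- The preimage of `s` is the morphism representing the functional `t ↦ tr (t ≫ s)`.
    obtain ⟨h, hh⟩ := (σ.iso X Y).surjective (σ.tr Y ∘ₗ Linear.rightComp k Y s)
    refine ⟨h, σ.eq_of_tr fun t => ?_⟩
    rw [← tr_comp, ← iso_apply, hh]
    rfl

/-- The other half of perfectness of the trace pairing; here reflexivity of finite-dimensional
spaces enters. -/
lemma exists_dual_eq (hD : HomFinite k D) {Y Z : D} (φ : Module.Dual k (Y ⟶ Z)) :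
    ∃ s : Z ⟶ S.obj Y, ∀ t, φ t = σ.tr Y (t ≫ s) := by
  have := hD Z (S.obj Y)
  obtain ⟨s, hs⟩ := (Module.evalEquiv k (Z ⟶ S.obj Y)).surjective
    ((σ.iso Y Z).symm.toLinearMap.dualMap φ)
  refine ⟨s, fun t => ?_⟩
  have := LinearMap.congr_fun hs (σ.iso Y Z t)
  simpa [iso_apply] using this.symm

include σ in
/-- A Serre duality whose functor is only an endofunctor is a Serre functor as soon as all the
functors `Hom(-, Y)` are of the form `Hom(Z, -)^*`. -/
lemma essSurj (hD : HomFinite k D)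
    (H : ∀ Y : D, ∃ (Z : D) (τ : Module.Dual k (Z ⟶ Y)), ∀ X : D,
      Function.Bijective
        (fun g : X ⟶ Y => (τ ∘ₗ Linear.rightComp k Z g : Module.Dual k (Z ⟶ X)))) :
    S.EssSurj where
  mem_essImage Y := by
    obtain ⟨Z, τ, hτ⟩ := H Y
    -- Both `Y` and `S Z` represent `Hom(Z, -)^*`, through `τ` and `tr Z`. Expressing each universal
    -- functional by the other gives mutually inverse maps.
    obtain ⟨θ, hθ⟩ := σ.exists_dual_eq hD τ
    obtain ⟨ψ, hψ⟩ := (hτ (S.obj Z)).2 (σ.tr Z)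
    have hψ' : ∀ t, τ (t ≫ ψ) = σ.tr Z t := fun t => LinearMap.congr_fun hψ t
    refine ⟨Z, ⟨⟨ψ, θ, σ.eq_of_tr fun t => ?_, (hτ Y).1 ?_⟩⟩⟩
    · rw [← Category.assoc, ← hθ, hψ', Category.comp_id]
    · ext t
      change τ (t ≫ θ ≫ ψ) = τ (t ≫ 𝟙 Y)
      rw [← Category.assoc, hψ', ← hθ, Category.comp_id]

/-- The Serre functor given by a Serre duality whose functor is an equivalence. -/
noncomputable def serreFunctor [S.Additive] [S.IsEquivalence] : SerreFunctor k D where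
  S := S.asEquivalence
  additive := by assumption
  iso := σ.iso
  naturality := σ.naturality

end RightSerre

/-- The Serre duality of a Serre functor. -/
def SerreFunctor.rightSerre (σ : SerreFunctor k C) : RightSerre k σ.S.functor where
  iso := σ.iso
  naturality := σ.naturality

/-- Serre duality restricts along a fully faithful functor that has a right adjoint. -/
noncomputable def RightSerre.ofAdjunction {S : C ⥤ C} (σ : RightSerre k S) {L : D ⥤ C} {G : C ⥤ D}
    (adj : L ⊣ G) [L.Additive] [L.Linear k] [L.Full] [L.Faithful] :
    RightSerre k (L ⋙ S ⋙ G) where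
  iso X Y := L.mapLinearEquiv k X Y ≪≫ₗ σ.iso _ _ ≪≫ₗ
    (adj.linearHomEquivSymm (k := k) Y (S.obj (L.obj X))).dualMap
  naturality f h g t := by
    have := σ.naturality (L.map f) (L.map h) (L.map g)
      (adj.linearHomEquivSymm (k := k) _ _ t)
    simpa using this

/-- Serre duality is inherited by a full subcategory `D` of a category `C` whose inclusions `L` and
`R` are left and right adjoint to the same functor `G : C ⥤ D`. -/
theorem SerreFunctor.nonempty_of_adjunctions (hC : HomFinite k C) (σ : SerreFunctor k C)
    {L : D ⥤ C} {G : C ⥤ D} {R : D ⥤ C} (adj₁ : L ⊣ G) (adj₂ : G ⊣ R)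
    [L.Additive] [L.Linear k] [L.Full] [L.Faithful] [G.Additive]
    [R.Additive] [R.Linear k] [R.Full] [R.Faithful] : Nonempty (SerreFunctor k D) := by
  have hD : HomFinite k D := hC.of_fullyFaithful L
  let ρ := σ.rightSerre.ofAdjunction adj₁
  have := σ.additive
  have := ρ.full
  have := ρ.faithful
  -- With `S W ≅ R Y`, one has `Hom(X, Y) ≅ Hom(R X, S W) ≅ Hom(W, R X)^* ≅ Hom(G W, X)^*`.
  have : (L ⋙ σ.S.functor ⋙ G).EssSurj := ρ.essSurj hD fun Y => by
    obtain ⟨W, ⟨e⟩⟩ : ∃ W, Nonempty (σ.S.functor.obj W ≅ R.obj Y) :=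
      ⟨_, ⟨σ.S.functor.objObjPreimageIso _⟩⟩
    let α := adj₂.linearHomEquiv (k := k) W Y
    refine ⟨G.obj W, (σ.rightSerre.tr W ∘ₗ Linear.rightComp k W e.inv) ∘ₗ α.toLinearMap,
      fun X => ⟨fun g g' h => ?_, fun φ => ?_⟩⟩
    · apply R.map_injective
      rw [← cancel_mono e.inv]
      refine σ.rightSerre.eq_of_tr fun t => ?_
      obtain ⟨s, rfl⟩ := (adj₂.linearHomEquiv (k := k) W X).surjective t
      simpa [α] using LinearMap.congr_fun h s
    · obtain ⟨s, hs⟩ := σ.rightSerre.exists_dual_eq hC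
        (φ ∘ₗ (adj₂.linearHomEquiv (k := k) W X).symm.toLinearMap)
      obtain ⟨g, hg⟩ := R.map_surjective (s ≫ e.hom)
      refine ⟨g, ?_⟩
      ext t
      have := hs (adj₂.linearHomEquiv (k := k) W X t)
      simp only [LinearMap.comp_apply, LinearEquiv.coe_coe, LinearEquiv.symm_apply_apply] at this
      simp [α, hg, this]
  have : (L ⋙ σ.S.functor ⋙ G).IsEquivalence := { }
  exact ⟨ρ.serreFunctor⟩

end RightSerre

/-! ### Adjunctions of exact functors on derived categories -/

section DerivedAdjunction

variable {A : Type u₁} [Category.{v₁} A] [Abelian A] {B : Type u₂} [Category.{v₂} B] [Abelian B]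

/-- An adjunction between additive functors induces an adjunction on complexes. -/
def CategoryTheory.Adjunction.mapHomologicalComplex {F : A ⥤ B} {G : B ⥤ A} (adj : F ⊣ G)
    [F.Additive] [G.Additive] {ι : Type*} (c : ComplexShape ι) :
    F.mapHomologicalComplex c ⊣ G.mapHomologicalComplex c :=
  Adjunction.mkOfUnitCounit
    { unit :=
        { app := fun K =>
            { f := fun i => adj.unit.app (K.X i)
              comm' := fun _ _ _ => (adj.unit.naturality _).symm }
          naturality := fun _ _ _ => by ext i; exact adj.unit.naturality _ }
      counit :=
        { app := fun K =>
            { f := fun i => adj.counit.app (K.X i)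
              comm' := fun _ _ _ => (adj.counit.naturality _).symm }
          naturality := fun _ _ _ => by ext i; exact adj.counit.naturality _ }
      left_triangle := by
        ext K i
        exact (congrArg (_ ≫ ·) (Category.id_comp _)).trans (adj.left_triangle_components (K.X i))
      right_triangle := by
        ext K i
        exact (congrArg (_ ≫ ·) (Category.id_comp _)).trans (adj.right_triangle_components (K.X i)) }

variable [HasDerivedCategory.{w₁} A] [HasDerivedCategory.{w₂} B]

namespace CategoryTheory.Functor

variable (F : A ⥤ B) [F.Additive] [PreservesFiniteLimits F] [PreservesFiniteColimits F]

noncomputable instance : CatCommSq (F.mapHomologicalComplex (ComplexShape.up ℤ))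
    DerivedCategory.Q DerivedCategory.Q F.mapDerivedCategory :=
  ⟨F.mapDerivedCategoryFactors.symm⟩

/-- Each bound is witnessed by a complex with vanishing terms, and termwise application of `F` keeps
zero terms. -/
lemma bounded_mapDerivedCategory_obj (X : DerivedCategory.Bounded A) :
    (DerivedCategory.TStructure.t : Triangulated.TStructure (DerivedCategory B)).bounded
      (F.mapDerivedCategory.obj X.obj) := by
  obtain ⟨⟨a, ⟨K, e, _⟩⟩, ⟨b, ⟨K', e', _⟩⟩⟩ := X.property
  exact ⟨⟨a, ⟨(F.mapHomologicalComplex (ComplexShape.up ℤ)).obj K,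
      F.mapDerivedCategory.mapIso e ≪≫ F.mapDerivedCategoryFactors.app K, inferInstance⟩⟩,
    ⟨b, ⟨(F.mapHomologicalComplex (ComplexShape.up ℤ)).obj K',
      F.mapDerivedCategory.mapIso e' ≪≫ F.mapDerivedCategoryFactors.app K', inferInstance⟩⟩⟩

/-- The functor between bounded derived categories induced by an exact functor. -/
noncomputable def mapBounded : DerivedCategory.Bounded A ⥤ DerivedCategory.Bounded B :=
  ObjectProperty.lift _ (DerivedCategory.Bounded.ι ⋙ F.mapDerivedCategory)
    F.bounded_mapDerivedCategory_obj

instance [F.mapDerivedCategory.Full] [F.mapDerivedCategory.Faithful] : F.mapBounded.Full := by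
  unfold mapBounded; infer_instance

instance [F.mapDerivedCategory.Faithful] : F.mapBounded.Faithful := by
  unfold mapBounded; infer_instance

instance : F.mapBounded.Additive where
  map_add {X Y f g} := by
    apply DerivedCategory.Bounded.ι.map_injective
    exact F.mapDerivedCategory.map_add (f := f.hom) (g := g.hom)

instance (k : Type w) [Field k] [CategoryTheory.Linear k A] [CategoryTheory.Linear k B]
    [F.Linear k] : F.mapBounded.Linear k where
  map_smul {X Y} f r := by
    apply DerivedCategory.Bounded.ι.map_injective
    exact Functor.Linear.map_smul (F := F.mapDerivedCategory) f.hom r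

end CategoryTheory.Functor

namespace CategoryTheory.Adjunction

variable {F : A ⥤ B} {G : B ⥤ A} (adj : F ⊣ G) [F.Additive] [G.Additive]
  [PreservesFiniteLimits F] [PreservesFiniteColimits F]
  [PreservesFiniteLimits G] [PreservesFiniteColimits G]

/-- An adjunction between exact functors induces an adjunction between derived categories. -/
noncomputable def mapDerivedCategory : F.mapDerivedCategory ⊣ G.mapDerivedCategory :=
  (adj.mapHomologicalComplex (ComplexShape.up ℤ)).localization
    DerivedCategory.Q (HomologicalComplex.quasiIso A (ComplexShape.up ℤ))
    DerivedCategory.Q (HomologicalComplex.quasiIso B (ComplexShape.up ℤ)) _ _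

/-- An adjunction between exact functors induces an adjunction between bounded derived
categories. -/
noncomputable def mapBounded : F.mapBounded ⊣ G.mapBounded :=
  adj.mapDerivedCategory.restrictFullyFaithful
    (ObjectProperty.fullyFaithfulι _) (ObjectProperty.fullyFaithfulι _)
    (Iso.refl _) (Iso.refl _)

-- Since `Q` is essentially surjective, the unit need only be checked on complexes, where it is
-- termwise `adj.unit`, an isomorphism.
include adj in
lemma mapDerivedCategory_fullyFaithful_left [F.Full] [F.Faithful] :
    F.mapDerivedCategory.Full ∧ F.mapDerivedCategory.Faithful := by
  have (X : DerivedCategory A) : IsIso (adj.mapDerivedCategory.unit.app X) := by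
    rw [← NatTrans.isIso_app_iff_of_iso _ (DerivedCategory.Q.objObjPreimageIso X)]
    generalize DerivedCategory.Q.objPreimage X = K
    have : IsIso ((adj.mapHomologicalComplex (ComplexShape.up ℤ)).unit.app K) := by
      have (i : ℤ) : IsIso (((adj.mapHomologicalComplex (ComplexShape.up ℤ)).unit.app K).f i) := by
        change IsIso (adj.unit.app (K.X i))
        infer_instance
      exact HomologicalComplex.Hom.isIso_of_components _
    rw [mapDerivedCategory, localization_unit_app]
    infer_instance
  have := NatIso.isIso_of_isIso_app adj.mapDerivedCategory.unit
  exact ⟨adj.mapDerivedCategory.fullyFaithfulLOfIsIsoUnit.full,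
    adj.mapDerivedCategory.fullyFaithfulLOfIsIsoUnit.faithful⟩

include adj in
lemma mapDerivedCategory_fullyFaithful_right [G.Full] [G.Faithful] :
    G.mapDerivedCategory.Full ∧ G.mapDerivedCategory.Faithful := by
  have (X : DerivedCategory B) : IsIso (adj.mapDerivedCategory.counit.app X) := by
    rw [← NatTrans.isIso_app_iff_of_iso _ (DerivedCategory.Q.objObjPreimageIso X)]
    generalize DerivedCategory.Q.objPreimage X = K
    have : IsIso ((adj.mapHomologicalComplex (ComplexShape.up ℤ)).counit.app K) := by
      have (i : ℤ) :
          IsIso (((adj.mapHomologicalComplex (ComplexShape.up ℤ)).counit.app K).f i) := by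
        change IsIso (adj.counit.app (K.X i))
        infer_instance
      exact HomologicalComplex.Hom.isIso_of_components _
    rw [mapDerivedCategory, localization_counit_app]
    infer_instance
  have := NatIso.isIso_of_isIso_app adj.mapDerivedCategory.counit
  exact ⟨adj.mapDerivedCategory.fullyFaithfulROfIsIsoCounit.full,
    adj.mapDerivedCategory.fullyFaithfulROfIsIsoCounit.faithful⟩

end CategoryTheory.Adjunction

end DerivedAdjunction

/-- Serre duality for abelian categories is inherited by a full subcategory `B` of an abelian
category `A` with exact inclusions `L` and `R` that are left and right adjoint to the same
functor. -/
theorem AbelianSerreDuality.of_adjunctions {k : Type w} [Field k]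
    {A : Type u₁} [Category.{v₁} A] [Abelian A] [CategoryTheory.Linear k A]
    {B : Type u₂} [Category.{v₂} B] [Abelian B] [CategoryTheory.Linear k B]
    (hA : AbelianSerreDuality k A)
    {L : B ⥤ A} {G : A ⥤ B} {R : B ⥤ A} (adj₁ : L ⊣ G) (adj₂ : G ⊣ R)
    [L.Additive] [L.Linear k] [L.Full] [L.Faithful] [PreservesFiniteLimits L] [G.Additive]
    [R.Additive] [R.Linear k] [R.Full] [R.Faithful] [PreservesFiniteColimits R] :
    AbelianSerreDuality k B := by
  let : HasDerivedCategory.{max u₁ v₁} A := HasDerivedCategory.standard A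
  let : HasDerivedCategory.{max u₂ v₂} B := HasDerivedCategory.standard B
  obtain ⟨hfin, ⟨σ⟩⟩ := hA
  -- Adjointness supplies the exactness not assumed: `L` and `R` each lack one half, and `G` is
  -- adjoint on both sides.
  have : PreservesFiniteColimits L :=
    have := adj₁.leftAdjoint_preservesColimits.{0, 0}
    inferInstance
  have : PreservesFiniteColimits G :=
    have := adj₂.leftAdjoint_preservesColimits.{0, 0}
    inferInstance
  have : PreservesFiniteLimits G :=
    have := adj₁.rightAdjoint_preservesLimits.{0, 0}
    inferInstance
  have : PreservesFiniteLimits R :=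
    have := adj₂.rightAdjoint_preservesLimits.{0, 0}
    inferInstance
  obtain ⟨_, _⟩ := adj₁.mapDerivedCategory_fullyFaithful_left
  obtain ⟨_, _⟩ := adj₂.mapDerivedCategory_fullyFaithful_right
  exact ⟨hfin.of_fullyFaithful L.mapBounded,
    SerreFunctor.nonempty_of_adjunctions hfin σ adj₁.mapBounded adj₂.mapBounded⟩

/-! ### Finite presentations -/

section PresentedBy

variable {I : Type u₁} [Category.{v₁} I] {E : Type u₂} [Category.{v₂} E] [HasZeroMorphisms E]
  {J : Type u₃} [Category.{v₃} J] {E' : Type u} [Category.{v} E'] [HasZeroMorphisms E']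
  {R : I ⥤ E} {R' : J ⥤ E'}

lemma PresentedBy.of_iso {M N : E} (hM : PresentedBy R M) (e : M ≅ N) : PresentedBy R N := by
  obtain ⟨A₁, A₀, f, p, hp, ⟨h⟩⟩ := hM
  exact ⟨A₁, A₀, f, p ≫ e.hom, by rw [reassoc_of% hp, zero_comp],
    ⟨IsColimit.ofIsoColimit h (Cofork.ext e)⟩⟩

lemma PresentedBy.obj (R : I ⥤ E) (X : I) : PresentedBy R (R.obj X) :=
  ⟨X, X, 0, 𝟙 _, zero_comp, ⟨CokernelCofork.IsColimit.ofId _ rfl⟩⟩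

lemma PresentedBy.exists_epi {M : E} (hM : PresentedBy R M) :
    ∃ (A : I) (p : R.obj A ⟶ M), Epi p := by
  obtain ⟨_, A₀, _, p, _, ⟨h⟩⟩ := hM
  exact ⟨A₀, p, Cofork.IsColimit.epi h⟩

/-- A functor preserving cokernels preserves finite presentations as soon as it does so for the
projective generators. -/
lemma PresentedBy.map {M : E} (hM : PresentedBy R M) (F : E ⥤ E') [F.PreservesZeroMorphisms]
    [PreservesFiniteColimits F] (hF : ∀ X, ∃ Y, Nonempty (F.obj (R.obj X) ≅ R'.obj Y)) :
    PresentedBy R' (F.obj M) := by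
  obtain ⟨A₁, A₀, f, p, hp, ⟨h⟩⟩ := hM
  obtain ⟨B₁, ⟨e₁⟩⟩ := hF A₁
  obtain ⟨B₀, ⟨e₀⟩⟩ := hF A₀
  have hFp : F.map f ≫ F.map p = 0 := by rw [← F.map_comp, hp, F.map_zero]
  let hF : IsColimit (CokernelCofork.ofπ (F.map p) hFp) := CokernelCofork.mapIsColimit _ h F
  have : Epi (F.map p) := Cofork.IsColimit.epi hF
  refine ⟨B₁, B₀, e₁.inv ≫ F.map f ≫ e₀.hom, e₀.inv ≫ F.map p, by simp [hFp],
    ⟨CokernelCofork.IsColimit.ofπ' _ _ fun g hg => ?_⟩⟩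
  have hg' : F.map f ≫ e₀.hom ≫ g = 0 := by
    rw [← cancel_epi e₁.inv]
    simpa using hg
  refine ⟨hF.desc (CokernelCofork.ofπ (e₀.hom ≫ g) hg'), ?_⟩
  rw [Category.assoc, Iso.inv_comp_eq]
  exact hF.fac _ WalkingParallelPair.one

end PresentedBy

/-! ### Finitely presented modules and pointwise duality -/

section Modules

variable {k : Type v} [Field k] {C : Type u₁} [Category.{v} C] [Preadditive C]
  [CategoryTheory.Linear k C]

lemma FPRight.exists_surjective {M : Cᵒᵖ ⥤ ModuleCat.{v} k} (hM : FPRight k C M) :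
    ∃ (A : C) (p : (linearYoneda k C).obj A ⟶ M), ∀ X, Function.Surjective (p.app X) := by
  obtain ⟨A, p, hp⟩ := PresentedBy.exists_epi hM
  exact ⟨A, p, fun X => (ModuleCat.epi_iff_surjective _).1 inferInstance⟩

lemma FPLeft.exists_surjective {N : C ⥤ ModuleCat.{v} k} (hN : FPLeft k C N) :
    ∃ (A : Cᵒᵖ) (p : (linearCoyoneda k C).obj A ⟶ N), ∀ X, Function.Surjective (p.app X) := by
  obtain ⟨A, p, hp⟩ := PresentedBy.exists_epi hN
  exact ⟨A, p, fun X => (ModuleCat.epi_iff_surjective _).1 inferInstance⟩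

lemma FPRight.finite (hC : HomFinite k C) {M : Cᵒᵖ ⥤ ModuleCat.{v} k} (hM : FPRight k C M)
    (X : Cᵒᵖ) : Module.Finite k (M.obj X) := by
  obtain ⟨A, p, hp⟩ := FPRight.exists_surjective hM
  have : Module.Finite k (((linearYoneda k C).obj A).obj X) := hC X.unop A
  exact Module.Finite.of_surjective (p.app X).hom (hp X)

lemma FPLeft.finite (hC : HomFinite k C) {N : C ⥤ ModuleCat.{v} k} (hN : FPLeft k C N)
    (X : C) : Module.Finite k (N.obj X) := by
  obtain ⟨A, p, hp⟩ := FPLeft.exists_surjective hN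
  have : Module.Finite k (((linearCoyoneda k C).obj A).obj X) := hC A.unop X
  exact Module.Finite.of_surjective (p.app X).hom (hp X)

/-- The action of morphisms on an element of a finitely presented right module is linear. -/
lemma FPRight.exists_linear {M : Cᵒᵖ ⥤ ModuleCat.{v} k} (hM : FPRight k C M) {Y : C}
    (n : M.obj (op Y)) (X : C) :
    ∃ l : (X ⟶ Y) →ₗ[k] M.obj (op X), ∀ h : X ⟶ Y, l h = M.map h.op n := by
  -- `M` is not assumed linear as a functor: linearity is inherited from composition in `C` by
  -- lifting `n` to a representable.
  obtain ⟨A, p, hp⟩ := FPRight.exists_surjective hM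
  obtain ⟨a, rfl⟩ := hp (op Y) n
  refine ⟨(p.app (op X)).hom ∘ₗ Linear.rightComp k X (show Y ⟶ A from a), fun h => ?_⟩
  exact congr($(p.naturality h.op) a)

/-- The linear map sending a morphism to its action on an element of a finitely presented right
module. -/
noncomputable def FPRight.act {M : Cᵒᵖ ⥤ ModuleCat.{v} k} (hM : FPRight k C M) {Y : C}
    (n : M.obj (op Y)) (X : C) : (X ⟶ Y) →ₗ[k] M.obj (op X) :=
  (hM.exists_linear n X).choose

@[simp]
lemma FPRight.act_apply {M : Cᵒᵖ ⥤ ModuleCat.{v} k} (hM : FPRight k C M) {Y : C}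
    (n : M.obj (op Y)) (X : C) (h : X ⟶ Y) : hM.act n X h = M.map h.op n :=
  (hM.exists_linear n X).choose_spec h

/-- The morphism from a representable module given by an element of a finitely presented module. -/
noncomputable def FPRight.homOfElement {M : Cᵒᵖ ⥤ ModuleCat.{v} k} (hM : FPRight k C M) {Y : C}
    (n : M.obj (op Y)) : (linearYoneda k C).obj Y ⟶ M where
  app X := ModuleCat.ofHom (hM.act n X.unop)
  naturality X Z h := by
    ext (t : X.unop ⟶ Y)
    change hM.act n Z.unop (h.unop ≫ t) = M.map h (hM.act n X.unop t)
    rw [act_apply, act_apply, op_comp, M.map_comp]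
    rfl

lemma FPRight.homOfElement_app {M : Cᵒᵖ ⥤ ModuleCat.{v} k} (hM : FPRight k C M) {X Y : C}
    (n : M.obj (op Y)) (h : X ⟶ Y) : (hM.homOfElement n).app (op X) h = M.map h.op n :=
  hM.act_apply n X h

/-- Monomorphisms of finitely presented right modules are pointwise injective. -/
lemma ModFP.injective_of_mono {M N : ModFP k C} (f : M ⟶ N) [Mono f] (X : Cᵒᵖ) :
    Function.Injective (f.hom.app X) := by
  refine (injective_iff_map_eq_zero (f.hom.app X).hom).2 fun x hx => ?_
  -- By Yoneda, `x` is a map from a representable, and `f` kills this map.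
  have hg : (ObjectProperty.homMk (M.property.homOfElement x) :
      (⟨_, PresentedBy.obj (linearYoneda k C) X.unop⟩ : ModFP k C) ⟶ M) = 0 := by
    rw [← cancel_mono f, zero_comp]
    ext Y (t : Y.unop ⟶ X.unop)
    change f.hom.app Y ((M.property.homOfElement x).app (op Y.unop) t) = 0
    rw [FPRight.homOfElement_app]
    refine (congr($(f.hom.naturality t.op) x)).trans ?_
    change N.obj.map t.op ((f.hom.app X).hom x) = 0
    rw [hx, map_zero]
  have h := congr(($hg).hom.app X (𝟙 X.unop))
  refine Eq.trans ?_ h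
  change _ = (M.property.homOfElement x).app (op X.unop) (𝟙 X.unop)
  rw [FPRight.homOfElement_app]
  simp

/-- Pointwise `k`-dual, from left to right modules. -/
def leftModuleDual (k : Type v) [Field k] (C : Type u₁) [Category.{v} C] :
    (C ⥤ ModuleCat.{v} k)ᵒᵖ ⥤ (Cᵒᵖ ⥤ ModuleCat.{v} k) where
  obj M :=
    { obj := fun X => ModuleCat.of k (Module.Dual k (M.unop.obj X.unop))
      map := fun f => ModuleCat.ofHom (M.unop.map f.unop).hom.dualMap
      map_id := fun X => by ext; simp
      map_comp := fun f g => by ext; simp }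
  map a :=
    { app := fun X => ModuleCat.ofHom (a.unop.app X.unop).hom.dualMap
      naturality := fun X Y f => by
        ext φ : 2
        refine LinearMap.ext fun x => ?_
        exact (congrArg (fun t => φ (t.hom x)) (a.unop.naturality f.unop)).symm }
  map_id M := by ext; simp
  map_comp a b := by ext; simp

/-- A pointwise finite dimensional right module is isomorphic to its double dual. -/
noncomputable def rightDoubleDualIso (M : Cᵒᵖ ⥤ ModuleCat.{v} k)
    (hM : ∀ X, Module.Finite k (M.obj X)) :
    M ≅ (leftModuleDual k C).obj (op ((moduleDual k C).obj (op M))) :=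
  NatIso.ofComponents
    (fun X => have := hM X; (Module.evalEquiv k (M.obj X)).toModuleIso) fun _ => rfl

/-- A pointwise finite dimensional left module is isomorphic to its double dual. -/
noncomputable def leftDoubleDualIso (N : C ⥤ ModuleCat.{v} k)
    (hN : ∀ X, Module.Finite k (N.obj X)) :
    N ≅ (moduleDual k C).obj (op ((leftModuleDual k C).obj (op N))) :=
  NatIso.ofComponents
    (fun X => have := hN X; (Module.evalEquiv k (N.obj X)).toModuleIso) fun _ => rfl

lemma LinearMap.exists_dualMap_eq {V W : Type*} [AddCommGroup V] [Module k V] [AddCommGroup W]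
    [Module k W] [Module.Finite k W] (g : Module.Dual k W →ₗ[k] Module.Dual k V) :
    ∃ f : V →ₗ[k] W, f.dualMap = g := by
  refine ⟨(Module.evalEquiv k W).symm ∘ₗ g.dualMap ∘ₗ Module.Dual.eval k V, ?_⟩
  ext φ x
  simp

lemma LinearMap.dualMap_inj {V W : Type*} [AddCommGroup V] [Module k V] [AddCommGroup W]
    [Module k W] {f g : V →ₗ[k] W} (h : f.dualMap = g.dualMap) : f = g := by
  ext x
  rw [← sub_eq_zero, ← Module.forall_dual_apply_eq_zero_iff k]
  intro φ
  rw [map_sub, sub_eq_zero]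
  exact LinearMap.congr_fun (LinearMap.congr_fun h φ) x

/-- A finite variety is dualizing if and only if pointwise duality preserves finitely presented
modules in both directions. -/
lemma isDualizing_iff (hC : IsFiniteVariety k C) : IsDualizing k C ↔
    (∀ M, FPRight k C M → FPLeft k C ((moduleDual k C).obj (op M))) ∧
      (∀ N, FPLeft k C N → FPRight k C ((leftModuleDual k C).obj (op N))) := by
  constructor
  · rintro ⟨_, h, _⟩
    refine ⟨fun M hM => h (op ⟨M, hM⟩), fun N hN => ?_⟩
    -- Only essential surjectivity is used: if `N ≅ D M`, then the dual of `N` is the double dual of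
    -- `M`, hence `M`.
    let F := (FPLeft k C).lift ((FPRight k C).ι.op ⋙ moduleDual k C) h
    let M := (F.objPreimage ⟨N, hN⟩).unop
    let e := (FPLeft k C).ι.mapIso (F.objObjPreimageIso ⟨N, hN⟩)
    exact M.property.of_iso (rightDoubleDualIso M.obj (M.property.finite hC.homFinite) ≪≫
      (leftModuleDual k C).mapIso e.symm.op)
  · rintro ⟨h₁, h₂⟩
    refine ⟨hC, fun M => h₁ _ M.unop.property, ?_⟩
    set F := (FPLeft k C).lift ((FPRight k C).ι.op ⋙ moduleDual k C) _
    have : F.Faithful := ⟨fun {M N f g} hfg => by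
      apply Quiver.Hom.unop_inj
      ext X : 4
      exact LinearMap.dualMap_inj (congr((($hfg).hom.app X.unop).hom))⟩
    have : F.Full := ⟨fun {M N} g => by
      have (X : Cᵒᵖ) := M.unop.property.finite hC.homFinite X
      -- Pointwise preimages suffice; their naturality follows because transposition is injective.
      choose f hf using fun X : Cᵒᵖ => LinearMap.exists_dualMap_eq
        (V := N.unop.obj.obj X) (W := M.unop.obj.obj X) (g.hom.app X.unop).hom
      refine ⟨Quiver.Hom.op (ObjectProperty.homMk ⟨fun X => ModuleCat.ofHom (f X),
        fun X Y h => ?_⟩), ?_⟩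
      · ext : 1
        apply LinearMap.dualMap_inj
        refine LinearMap.ext fun (φ : Module.Dual k (M.unop.obj.obj Y)) => LinearMap.ext fun x => ?_
        have hf' (Z : Cᵒᵖ) (ψ : Module.Dual k (M.unop.obj.obj Z)) (z : N.unop.obj.obj Z) :
            ψ (f Z z) = (show Module.Dual k (N.unop.obj.obj Z) from
              (g.hom.app Z.unop).hom ψ) z :=
          LinearMap.congr_fun (LinearMap.congr_fun (hf Z) ψ) z
        refine (hf' Y φ _).trans (Eq.trans ?_ (hf' X (φ ∘ₗ (M.unop.obj.map h).hom) x).symm)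
        exact LinearMap.congr_fun (congr($(g.hom.naturality h.unop) φ)).symm x
      · ext X : 4
        exact hf (op X)⟩
    have : F.EssSurj := ⟨fun N => ⟨op ⟨_, h₂ _ N.property⟩,
      ⟨(FPLeft k C).isoMk (leftDoubleDualIso N.obj (N.property.finite hC.homFinite)).symm⟩⟩⟩
    exact { }

/-- Epimorphisms of finitely presented right modules over a dualizing variety are pointwise
surjective. -/
lemma ModFP.surjective_of_epi (hC : IsDualizing k C) {M N : ModFP k C} (f : M ⟶ N) [Epi f]
    (X : Cᵒᵖ) : Function.Surjective (f.hom.app X) := by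
  change Function.Surjective (f.hom.app X).hom
  rw [← LinearMap.dualMap_injective_iff, injective_iff_map_eq_zero]
  intro φ hφ
  -- The dual of `C(X, -)` is finitely presented, and a functional `φ` on `N(X)` yields the map `n ↦
  -- (h ↦ φ (N(h) n))` into it. If `φ` vanishes on the image of `f`, this map dies on the
  -- epimorphism `f`.
  have hD := ((isDualizing_iff hC.isFiniteVariety).1 hC).2 _
    (PresentedBy.obj (linearCoyoneda k C) X)
  let g : N ⟶ (⟨_, hD⟩ : ModFP k C) := ObjectProperty.homMk
    { app := fun Y => ModuleCat.ofHom
        { toFun := fun n => φ ∘ₗ N.property.act (Y := Y.unop) n X.unop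
          map_add' := fun n n' => by
            refine LinearMap.ext fun (h : X.unop ⟶ Y.unop) => ?_
            change φ (N.property.act (Y := Y.unop) (n + n') X.unop h) =
              φ (N.property.act (Y := Y.unop) n X.unop h) +
                φ (N.property.act (Y := Y.unop) n' X.unop h)
            simp only [FPRight.act_apply, map_add]
          map_smul' := fun r n => by
            refine LinearMap.ext fun (h : X.unop ⟶ Y.unop) => ?_
            change φ (N.property.act (Y := Y.unop) (r • n) X.unop h) =
              r • φ (N.property.act (Y := Y.unop) n X.unop h)
            simp only [FPRight.act_apply, map_smul] }
      naturality := fun Y Z h => by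
        ext n
        refine LinearMap.ext fun (t : X.unop ⟶ Z.unop) => ?_
        change φ (N.property.act (Y := Z.unop) (N.obj.map h n) X.unop t) =
          φ (N.property.act (Y := Y.unop) n X.unop (t ≫ h.unop))
        rw [FPRight.act_apply, FPRight.act_apply, op_comp, N.obj.map_comp]
        rfl }
  have hg : g = 0 := by
    rw [← cancel_epi f, comp_zero]
    ext Y n
    refine LinearMap.ext fun (t : X.unop ⟶ Y.unop) => ?_
    change φ (N.property.act (Y := Y.unop) (f.hom.app Y n) X.unop t) = 0
    rw [FPRight.act_apply]
    refine (congrArg φ (congr($(f.hom.naturality t.op) n))).symm.trans ?_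
    exact LinearMap.congr_fun hφ (M.obj.map t.op n)
  ext n
  have h : φ (N.property.act (Y := X.unop) n X.unop (𝟙 X.unop)) = 0 :=
    LinearMap.congr_fun (congr(($hg).hom.app X n)) (𝟙 X.unop)
  rw [FPRight.act_apply] at h
  simpa using h

end Modules

/-! ### Restriction along adjoint functors -/

section Restriction

variable {k : Type v} [Field k] {C : Type u₁} [Category.{v} C] [Preadditive C]
  [CategoryTheory.Linear k C] {D : Type u₂} [Category.{v} D] [Preadditive D]
  [CategoryTheory.Linear k D] {F : C ⥤ D} {G : D ⥤ C}

namespace CategoryTheory.Adjunction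

lemma left_adjoint_linear (adj : F ⊣ G) [G.Linear k] : F.Linear k where
  map_smul f r := by
    apply (adj.homEquiv _ _).injective
    simp [homEquiv_unit]

lemma right_adjoint_linear (adj : F ⊣ G) [F.Linear k] : G.Linear k where
  map_smul f r := by
    apply (adj.homEquiv _ _).symm.injective
    simp [homEquiv_counit]

variable (k) in
/-- The restriction of a representable right module along a left adjoint is representable. -/
def linearYonedaIso (adj : F ⊣ G) [F.Additive] [F.Linear k] (Y : D) :
    F.op ⋙ (linearYoneda k D).obj Y ≅ (linearYoneda k C).obj (G.obj Y) :=
  NatIso.ofComponents (fun X => (adj.linearHomEquivSymm (k := k) X.unop Y).symm.toModuleIso)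
    fun {X Z} h => by
      ext t
      exact adj.homEquiv_naturality_left h.unop t

variable (k) in
/-- The restriction of a representable left module along a right adjoint is representable. -/
def linearCoyonedaIso (adj : F ⊣ G) [G.Additive] [G.Linear k] (X : C) :
    G ⋙ (linearCoyoneda k C).obj (Opposite.op X) ≅
      (linearCoyoneda k D).obj (Opposite.op (F.obj X)) :=
  NatIso.ofComponents (fun Y => (adj.linearHomEquiv (k := k) X Y).symm.toModuleIso)
    fun {X Z} h => by
      ext t
      exact adj.homEquiv_naturality_right_symm t h

end CategoryTheory.Adjunction

lemma FPRight.comp_op (adj : F ⊣ G) [F.Additive] [F.Linear k] {M : Dᵒᵖ ⥤ ModuleCat.{v} k}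
    (hM : FPRight k D M) : FPRight k C (F.op ⋙ M) :=
  PresentedBy.map hM ((Functor.whiskeringLeft _ _ _).obj F.op)
    fun Y => ⟨G.obj Y, ⟨adj.linearYonedaIso k Y⟩⟩

lemma FPLeft.comp (adj : F ⊣ G) [G.Additive] [G.Linear k] {N : C ⥤ ModuleCat.{v} k}
    (hN : FPLeft k C N) : FPLeft k D (G ⋙ N) :=
  PresentedBy.map hN ((Functor.whiskeringLeft _ _ _).obj G)
    fun X => ⟨op (F.obj X.unop), ⟨adj.linearCoyonedaIso k X.unop⟩⟩

/-- Restriction of finitely presented right modules along a functor that preserves them. -/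
def ModFP.restrict (F : C ⥤ D) (h : ∀ M, FPRight k D M → FPRight k C (F.op ⋙ M)) :
    ModFP k D ⥤ ModFP k C :=
  (FPRight k C).lift ((FPRight k D).ι ⋙ (Functor.whiskeringLeft _ _ _).obj F.op)
    fun M => h _ M.property

instance (h : ∀ M, FPRight k D M → FPRight k C (F.op ⋙ M)) :
    (ModFP.restrict F h).Additive where

instance (h : ∀ M, FPRight k D M → FPRight k C (F.op ⋙ M)) :
    (ModFP.restrict F h).Linear k where

/-- An adjunction `F ⊣ G` induces an adjunction between the restriction functors of finitely
presented right modules. -/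
noncomputable def ModFP.restrictAdjunction (adj : F ⊣ G)
    (hF : ∀ M, FPRight k D M → FPRight k C (F.op ⋙ M))
    (hG : ∀ M, FPRight k C M → FPRight k D (G.op ⋙ M)) :
    ModFP.restrict F hF ⊣ ModFP.restrict G hG :=
  (adj.op.whiskerLeft (ModuleCat.{v} k)).restrictFullyFaithful
    (ObjectProperty.fullyFaithfulι _) (ObjectProperty.fullyFaithfulι _)
    (Iso.refl _) (Iso.refl _)

/-- If `F ⋙ G ≅ 𝟭 C`, restriction along `G` followed by restriction along `F` is the identity. -/
def ModFP.restrictCompIso (e : F ⋙ G ≅ 𝟭 C)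
    (hF : ∀ M, FPRight k D M → FPRight k C (F.op ⋙ M))
    (hG : ∀ M, FPRight k C M → FPRight k D (G.op ⋙ M)) :
    ModFP.restrict G hG ⋙ ModFP.restrict F hF ≅ 𝟭 (ModFP k C) :=
  NatIso.ofComponents
    (fun M => (FPRight k C).isoMk
      (NatIso.ofComponents (fun X => M.obj.mapIso (e.symm.app X.unop).op) fun f => by
        change M.obj.map _ ≫ M.obj.map _ = M.obj.map _ ≫ M.obj.map _
        rw [← M.obj.map_comp, ← M.obj.map_comp]
        exact congrArg M.obj.map (Quiver.Hom.unop_inj (e.inv.naturality f.unop).symm)))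
    fun f => by
      ext X : 3
      exact (f.hom.naturality _).symm

lemma ModFP.preservesMonomorphisms_restrict
    (h : ∀ M, FPRight k D M → FPRight k C (F.op ⋙ M)) :
    (ModFP.restrict F h).PreservesMonomorphisms where
  preserves f _ := ⟨fun g g' hg => by
    ext X x
    exact injective_of_mono f (F.op.obj X) (congr(($hg).hom.app X x))⟩

lemma ModFP.preservesEpimorphisms_restrict (hD : IsDualizing k D)
    (h : ∀ M, FPRight k D M → FPRight k C (F.op ⋙ M)) :
    (ModFP.restrict F h).PreservesEpimorphisms where
  preserves {M N} f _ := ⟨fun {P} g g' hg => by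
    ext X y
    obtain ⟨x, rfl⟩ := surjective_of_epi hD f (F.op.obj X) y
    exact congr(($hg).hom.app X x)⟩

end Restriction

/-! ### Descent along `l ⊣ i ⊣ r` -/

section Recollement

variable {k : Type v} [Field k] {C : Type u₁} [Category.{v} C] [Preadditive C]
  [CategoryTheory.Linear k C] {D : Type u₂} [Category.{v} D] [Preadditive D]
  [CategoryTheory.Linear k D] {i : D ⥤ C} [i.Additive] [i.Linear k]
  {l r : C ⥤ D}

/-- Since `r` need not have a right adjoint, representable right modules may not restrict to
representables. Left modules do behave, as `D(X, r -) ≅ C(i X, -)`, so one dualizes, restricts and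
dualizes back. -/
lemma FPRight.comp_op_of_isDualizing (hC : IsDualizing k C) (hD : IsDualizing k D)
    (adjr : i ⊣ r) {M : Dᵒᵖ ⥤ ModuleCat.{v} k} (hM : FPRight k D M) :
    FPRight k C (r.op ⋙ M) := by
  have := adjr.right_adjoint_additive
  have := adjr.right_adjoint_linear (k := k)
  have h := ((isDualizing_iff hC.isFiniteVariety).1 hC).2 _
    (FPLeft.comp adjr (((isDualizing_iff hD.isFiniteVariety).1 hD).1 _ hM))
  exact h.of_iso (Functor.isoWhiskerLeft r.op
    (rightDoubleDualIso M (hM.finite hD.isFiniteVariety.homFinite)).symm)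

variable [i.Full] [i.Faithful]

/-- A full subcategory of a dualizing variety that is a finite variety, and is both reflective and
coreflective, is dualizing. -/
theorem IsDualizing.of_adjunctions (hC : IsDualizing k C) (hD : IsFiniteVariety k D)
    (adjl : l ⊣ i) (adjr : i ⊣ r) : IsDualizing k D := by
  have := adjl.left_adjoint_additive
  have := adjl.left_adjoint_linear (k := k)
  have := adjr.right_adjoint_additive
  have := adjr.right_adjoint_linear (k := k)
  obtain ⟨h₁, h₂⟩ := (isDualizing_iff hC.isFiniteVariety).1 hC
  refine (isDualizing_iff hD).2 ⟨fun M hM => ?_, fun N hN => ?_⟩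
  -- Extend along `l`, dualize over `C`, restrict along `i`; the counit `i ⋙ l ≅ 𝟭` removes the
  -- detour. Left modules use `r` instead.
  · have h := FPLeft.comp adjl (h₁ _ (FPRight.comp_op adjl hM))
    exact h.of_iso ((moduleDual k D).mapIso
      (Functor.isoWhiskerRight (NatIso.op (asIso adjl.counit)) M).op)
  · have h := FPRight.comp_op adjr (h₂ _ (FPLeft.comp adjr hN))
    exact h.of_iso ((leftModuleDual k D).mapIso
      (Functor.isoWhiskerRight (asIso adjr.unit) N).op)

/-- Serre duality of the finitely presented modules is inherited by full subcategories that are both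
reflective and coreflective. -/
theorem SatisfiesSerreDuality.of_adjunctions (hC : IsDualizing k C) (hD : IsDualizing k D)
    (adjl : l ⊣ i) (adjr : i ⊣ r) (h : SatisfiesSerreDuality k (ModFP k C)) :
    SatisfiesSerreDuality k (ModFP k D) := by
  obtain ⟨hab, hS⟩ := h
  let := hab.abelian
  have := adjl.left_adjoint_additive
  have := adjl.left_adjoint_linear (k := k)
  have hi (M) (hM : FPRight k C M) : FPRight k D (i.op ⋙ M) := FPRight.comp_op adjr hM
  have hl (M) (hM : FPRight k D M) : FPRight k C (l.op ⋙ M) := FPRight.comp_op adjl hM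
  have hr (M) (hM : FPRight k D M) : FPRight k C (r.op ⋙ M) :=
    FPRight.comp_op_of_isDualizing hC hD adjr hM
  let G := ModFP.restrict i hi
  let L := ModFP.restrict l hl
  let R := ModFP.restrict r hr
  let adj₁ : L ⊣ G := ModFP.restrictAdjunction adjl hl hi
  let adj₂ : G ⊣ R := ModFP.restrictAdjunction adjr hi hr
  let eL : L ⋙ G ≅ 𝟭 _ := ModFP.restrictCompIso (asIso adjl.counit) hi hl
  let eR : R ⋙ G ≅ 𝟭 _ := ModFP.restrictCompIso (asIso adjr.unit).symm hi hr
  have := adj₁.isIso_unit_of_iso eL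
  have := adj₂.isIso_counit_of_iso eR
  have : L.Full := adj₁.fullyFaithfulLOfIsIsoUnit.full
  have : L.Faithful := adj₁.fullyFaithfulLOfIsIsoUnit.faithful
  have : R.Full := adj₂.fullyFaithfulROfIsIsoCounit.full
  have : R.Faithful := adj₂.fullyFaithfulROfIsIsoCounit.faithful
  have : PreservesFiniteLimits G :=
    have := adj₁.rightAdjoint_preservesLimits.{0, 0}
    inferInstance
  have : PreservesFiniteLimits R :=
    have := adj₂.rightAdjoint_preservesLimits.{0, 0}
    inferInstance
  have : PreservesFiniteColimits L :=
    have := adj₁.leftAdjoint_preservesColimits.{0, 0}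
    inferInstance
  -- `mod D` is a reflective subcategory of `mod C` with left exact reflector `G`, hence abelian.
  let : Reflective R := { L := G, adj := adj₂ }
  have : HasFiniteProducts (ModFP k D) := ⟨fun _ => hasLimitsOfShape_of_reflective R⟩
  let : Abelian (ModFP k D) := abelianOfAdjunction R G eR adj₂
  -- The left adjoint `L` becomes exact by preserving monos, the right adjoint `R` by preserving
  -- epis; the latter needs `D` dualizing.
  have := ModFP.preservesMonomorphisms_restrict hl
  have := ModFP.preservesEpimorphisms_restrict hD hr
  have : L.PreservesHomology := L.preservesHomology_of_preservesMonos_and_cokernels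
  have : R.PreservesHomology := R.preservesHomology_of_preservesEpis_and_kernels
  have := L.preservesFiniteLimits_of_preservesHomology
  have := R.preservesFiniteColimits_of_preservesHomology
  exact ⟨⟨inferInstance, inferInstance, inferInstance, inferInstance, inferInstance⟩,
    AbelianSerreDuality.of_adjunctions hS adj₁ adj₂⟩

end Recollement

theorem mainTheorem9 {k : Type v} [Field k] [IsAlgClosed k]
    {𝔞 : Type u₁} [Category.{v} 𝔞] [Preadditive 𝔞] [CategoryTheory.Linear k 𝔞]
    {𝔟 : Type u₂} [Category.{v} 𝔟] [Preadditive 𝔟] [CategoryTheory.Linear k 𝔟]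
    (h𝔞 : IsDualizing k 𝔞) (h𝔟 : IsFiniteVariety k 𝔟)
    (i : 𝔟 ⥤ 𝔞) [i.Additive] [i.Linear k] [i.Full] [i.Faithful]
    -- `i` has a right adjoint, and `i` has a left adjoint
    (hR : i.IsLeftAdjoint) (hL : i.IsRightAdjoint) :
    IsDualizing k 𝔟 ∧
      (SatisfiesSerreDuality k (ModFP k 𝔞) → SatisfiesSerreDuality k (ModFP k 𝔟)) := by
  have hD := h𝔞.of_adjunctions h𝔟 (Adjunction.ofIsRightAdjoint i) (Adjunction.ofIsLeftAdjoint i)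
  exact ⟨hD, .of_adjunctions h𝔞 hD (Adjunction.ofIsRightAdjoint i) (Adjunction.ofIsLeftAdjoint i)⟩
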